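/- **Theorem 3.2.** Let $K$ be a field, let $0<a<b<c$ be integers, and let $I=(x^c,\;x^by^a,\;x^ay^b,\;y^c)\subset S=K[x,y]$. Let $\mathfrak m=(x,y)$, let $R(I)=\bigoplus_{k\ge 0}I^k$ be the Rees ring of $I$, and let $F(I)=R(I)/\mathfrak m R(I)$ be the fiber cone of $I$, a standard graded $K$-algebra. Its depth is the maximal length of a regular sequence on $F(I)$ contained in the graded maximal ideal $\bigoplus_{k\ge1}I^k/\mathfrak mI^k$. A monomial ideal of $S$ is called convex (respectively concave) if the exponent vectors $\mathbf c_1,\dots,\mathbf c_m\in\mathbb Z_{\ge0}^2$ of its minimal monomial generators, listed in decreasing lexicographic order with $x>y$, satisfy the componentwise inequalities $2\mathbf c_i\le\mathbf c_{i-1}+\mathbf c_{i+1}$ (respectively $2\mathbf c_i\ge\mathbf c_{i-1}+\mathbf c_{i+1}$) for all $1<i<m$. 1. If $2a\le b$ and $2b\le a+c$, then $I$ is convex, $\operatorname{depth}F(I)=2$, and $F(I)$ is Cohen–Macaulay. 2. If $2a\ge b$ and $2b\ge a+c$, then $I$ is concave, $\operatorname{depth}F(I)=2$, and $F(I)$ is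 Cohen–Macaulay. -/

import Mathlib

noncomputable section

namespace FiberCone

open MvPolynomial RingTheory.Sequence

/-! ### Depth and Cohen–Macaulay rings -/

/-- The depth of an ideal `J` on the ring `R`: the supremum of the lengths of the regular
sequences on `R` whose entries lie in `J`. -/
def depthOf {R : Type*} [CommRing R] (J : Ideal R) : ℕ∞ :=
  ⨆ (rs : List R) (_ : (∀ r ∈ rs, r ∈ J) ∧ IsRegular R rs), (rs.length : ℕ∞)

/-- A commutative ring is Cohen–Macaulay if it is Noetherian and each of its localizations at a
maximal ideal has depth equal to its Krull dimension. -/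
def IsCohenMacaulayRing (R : Type*) [CommRing R] : Prop :=
  IsNoetherianRing R ∧
    ∀ (m : Ideal R) [m.IsMaximal],
      (depthOf (IsLocalRing.maximalIdeal (Localization.AtPrime m)) : WithBot ℕ∞) =
        ringKrullDim (Localization.AtPrime m)

/-! ### The fiber cone of an ideal of `K[x, y]` -/

/-- The graded maximal ideal `(x, y)` of `K[x, y]`. -/
def gradedMaxIdeal (K : Type*) [Field K] : Ideal (MvPolynomial (Fin 2) K) :=
  Ideal.span {X 0, X 1}

/-- The fiber cone `F(I) = R(I) / 𝔪 R(I)`, where `R(I) = ⨁ₖ Iᵏ` is the Rees ring of `I`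
and `𝔪 = (x, y)`. -/
abbrev fiberCone {K : Type*} [Field K] (I : Ideal (MvPolynomial (Fin 2) K)) : Type _ :=
  reesAlgebra I ⧸
    (gradedMaxIdeal K).map (algebraMap (MvPolynomial (Fin 2) K) (reesAlgebra I))

/-- The ideal `⨁_{k ≥ 1} Iᵏ` of the Rees ring, that is, the elements of the Rees ring
whose component of degree zero vanishes. -/
def reesIrrelevant {K : Type*} [Field K] (I : Ideal (MvPolynomial (Fin 2) K)) :
    Ideal (reesAlgebra I) :=
  RingHom.ker ((Polynomial.constantCoeff (R := MvPolynomial (Fin 2) K)).comp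
    (reesAlgebra I).val.toRingHom)

/-- The ideal `F(I)₊ = ⨁_{k ≥ 1} F(I)ₖ` of the fiber cone. Since `F(I)₀ = K` is a field, it is
the graded maximal ideal of `F(I)`. -/
def fiberConeIrrelevant {K : Type*} [Field K] (I : Ideal (MvPolynomial (Fin 2) K)) :
    Ideal (fiberCone I) :=
  (reesIrrelevant I).map (Ideal.Quotient.mk _)

/-- The depth of the fiber cone as a standard graded `K`-algebra: the maximal length of
a regular sequence in its graded maximal ideal. -/
def fiberConeDepth {K : Type*} [Field K] (I : Ideal (MvPolynomial (Fin 2) K)) : ℕ∞ :=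
  depthOf (R := fiberCone I) (fiberConeIrrelevant I)

/-! ### Monomial ideals, convex and concave -/

/-- The monomial `x ^ e.1 * y ^ e.2` with exponent vector `e`. -/
def mono (K : Type*) [Field K] (e : ℕ × ℕ) : MvPolynomial (Fin 2) K :=
  X 0 ^ e.1 * X 1 ^ e.2

/-- Monomial ideals: the ideals generated by monomials. -/
def IsMonomialIdeal {K : Type*} [Field K] (I : Ideal (MvPolynomial (Fin 2) K)) : Prop :=
  ∃ A : Set (ℕ × ℕ), I = Ideal.span (mono K '' A)

/-- The exponent vectors of `G(I)`, the minimal set of monomial generators of a monomial ideal: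
these are the monomials in `I` which are minimal with respect to divisibility. The order on
`ℕ × ℕ` is the componentwise one. -/
def genExponents {K : Type*} [Field K] (I : Ideal (MvPolynomial (Fin 2) K)) : Set (ℕ × ℕ) :=
  {e | Minimal (fun v => mono K v ∈ I) e}

/-- `u` lists the exponent vectors of `G(I)` in such a way that the corresponding monomials
decrease lexicographically (with `x > y`). -/
def IsExponentSequence {K : Type*} [Field K] (I : Ideal (MvPolynomial (Fin 2) K)) {m : ℕ}
    (u : Fin m → ℕ × ℕ) : Prop :=
  StrictAnti (fun i => toLex (u i)) ∧ Set.range u = genExponents I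

/-- The sequence `u` of vectors satisfies `2 uᵢ ≤ uᵢ₋₁ + uᵢ₊₁` at all inner indices, where
inequalities are meant componentwise. -/
def IsConvexSeq {m : ℕ} (u : Fin m → ℕ × ℕ) : Prop :=
  ∀ i j k : Fin m, (i : ℕ) + 1 = j → (j : ℕ) + 1 = k → 2 • u j ≤ u i + u k

/-- The sequence `u` of vectors satisfies `2 uᵢ ≥ uᵢ₋₁ + uᵢ₊₁` at all inner indices, where
inequalities are meant componentwise. -/
def IsConcaveSeq {m : ℕ} (u : Fin m → ℕ × ℕ) : Prop :=
  ∀ i j k : Fin m, (i : ℕ) + 1 = j → (j : ℕ) + 1 = k → u i + u k ≤ 2 • u j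

/-- A monomial ideal is convex if the exponent vectors of its minimal monomial generators, ordered
lexicographically, form a convex sequence. -/
def IsConvexIdeal {K : Type*} [Field K] (I : Ideal (MvPolynomial (Fin 2) K)) : Prop :=
  IsMonomialIdeal I ∧ ∃ (m : ℕ) (u : Fin m → ℕ × ℕ), IsExponentSequence I u ∧ IsConvexSeq u

/-- A monomial ideal is concave if the exponent vectors of its minimal monomial generators, ordered
lexicographically, form a concave sequence. -/
def IsConcaveIdeal {K : Type*} [Field K] (I : Ideal (MvPolynomial (Fin 2) K)) : Prop :=
  IsMonomialIdeal I ∧ ∃ (m : ℕ) (u : Fin m → ℕ × ℕ), IsExponentSequence I u ∧ IsConcaveSeq u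

/-- The symmetric ideal `(x^c, x^b y^a, x^a y^b, y^c)` of `K[x, y]`. -/
def symmetricIdeal (K : Type*) [Field K] (a b c : ℕ) : Ideal (MvPolynomial (Fin 2) K) :=
  Ideal.span {X 0 ^ c, X 0 ^ b * X 1 ^ a, X 0 ^ a * X 1 ^ b, X 1 ^ c}

end FiberCone

end

noncomputable section

namespace FiberCone

open MvPolynomial RingTheory.Sequence

/-! ### Depth of finite free algebras over a polynomial ring in two variables -/

/-! The classes T₀, …, T₃ of the four generators generate F(I) over K. A product of generators
vanishes in F(I) when another product of equally many generators properly divides it. Conversely, a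
monomial whose exponent vector is minimal among products of its degree, and which occurs in a
relation as the only monomial of that degree and exponent vector, has coefficient zero there
(`coeff_eq_zero_of_aeval_fiberGen_eq_zero`).

The hypotheses give a + b ≤ c in part 1 and c ≤ a + b in part 2, with equality only for b = 2a, c =
3a, so three rings occur. If a + b < c, then T₀T₂ = T₁T₃ = T₀T₃ = 0 and F(I) is the Stanley–Reisner
ring of the path 0–1–2–3, free over K[T₀ + T₂, T₁ + T₃] with basis 1, T₀, T₃. If a + b > c, then T₁²
= T₁T₂ = T₂² = 0, and F(I) is free over K[T₀, T₃] with basis 1, T₁, T₂. If a + b = c, these three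
products equal T₀T₂, T₀T₃, T₁T₃; this is the twisted cubic cone, free with the same basis.

A finite free algebra over K[X, Y] is Cohen–Macaulay, and every proper ideal containing the images
of X and Y has depth 2 (`isCohenMacaulayRing_and_depthOf_eq_two`): regular sequences ascend along
flat maps, and integrality bounds the dimension by 2. -/

theorem isWeaklyRegular_pair_of_isRelPrime {A : Type*} [CommRing A] [IsDomain A]
    [DecompositionMonoid A] {f g : A} (hf : f ≠ 0) (hfg : IsRelPrime f g) :
    IsWeaklyRegular A [f, g] := by
  rw [isWeaklyRegular_cons_iff, isWeaklyRegular_singleton_iff]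
  refine ⟨IsSMulRegular.of_right_eq_zero_of_smul fun x hx => ?_, ?_⟩
  · simpa [hf] using hx
  · unfold QuotSMulTop
    rw [isSMulRegular_quotient_iff_mem_of_smul_mem]
    intro x hx
    rw [Submodule.mem_smul_pointwise_iff_exists] at hx ⊢
    obtain ⟨y, -, hy⟩ := hx
    obtain ⟨z, hz⟩ := hfg.dvd_of_dvd_mul_left (Dvd.intro y hy : f ∣ g * x)
    exact ⟨z, trivial, hz.symm⟩

theorem degreeOf_aeval_X_eq_zero {K : Type*} [Field K] {i j : Fin 2} (hij : i ≠ j)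
    (p : Polynomial K) :
    degreeOf j (Polynomial.aeval (X i : MvPolynomial (Fin 2) K) p) = 0 := by
  rw [Polynomial.aeval_eq_sum_range]
  refine Nat.le_zero.mp ((degreeOf_sum_le _ _ _).trans (Finset.sup_le fun k _ => ?_))
  rw [MvPolynomial.smul_eq_C_mul]
  refine (degreeOf_C_mul_le _ _ _).trans ((degreeOf_pow_le _ _ _).trans ?_)
  simp [degreeOf_X_of_ne hij.symm]

theorem aeval_X_ne_zero {K : Type*} [Field K] {p : Polynomial K} (hp : p ≠ 0) (i : Fin 2) :
    Polynomial.aeval (X i : MvPolynomial (Fin 2) K) p ≠ 0 :=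
  fun h => hp (transcendental_iff.mp (MvPolynomial.transcendental_X K i) p h)

/-- Degrees in each variable add under multiplication, so a common divisor involves neither variable
and is a nonzero constant. -/
theorem isRelPrime_aeval_X {K : Type*} [Field K] {p q : Polynomial K} (hp : p ≠ 0) (hq : q ≠ 0) :
    IsRelPrime (Polynomial.aeval (X 0 : MvPolynomial (Fin 2) K) p)
      (Polynomial.aeval (X 1 : MvPolynomial (Fin 2) K) q) := by
  rintro d ⟨u, hu⟩ ⟨v, hv⟩
  have hp' := aeval_X_ne_zero hp 0
  have hq' := aeval_X_ne_zero hq 1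
  have h0 : degreeOf 0 d = 0 := by
    have := degreeOf_aeval_X_eq_zero (show (1 : Fin 2) ≠ 0 by decide) q
    rw [hv, degreeOf_mul_eq (left_ne_zero_of_mul (hv ▸ hq')) (right_ne_zero_of_mul (hv ▸ hq'))]
      at this
    omega
  have h1 : degreeOf 1 d = 0 := by
    have := degreeOf_aeval_X_eq_zero (show (0 : Fin 2) ≠ 1 by decide) p
    rw [hu, degreeOf_mul_eq (left_ne_zero_of_mul (hu ▸ hp')) (right_ne_zero_of_mul (hu ▸ hp'))]
      at this
    omega
  have hvars : d.vars = ∅ := by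
    refine Finset.eq_empty_of_forall_notMem fun i hi => ?_
    rw [vars_def, Multiset.mem_toFinset, ← Multiset.count_pos] at hi
    rw [degreeOf_def] at h0 h1
    fin_cases i
    · exact absurd h0 hi.ne'
    · exact absurd h1 hi.ne'
  rw [vars_eq_empty_iff_eq_C] at hvars
  have hd : d ≠ 0 := left_ne_zero_of_mul (hu ▸ hp')
  rw [hvars] at hd ⊢
  exact (IsUnit.mk0 _ fun h => hd (by rw [h, map_zero])).map C

theorem ringKrullDim_le_of_isIntegral (A R : Type*) [CommRing A] [CommRing R] [Algebra A R]
    [Algebra.IsIntegral A R] : ringKrullDim R ≤ ringKrullDim A :=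
  Order.krullDim_le_of_strictMono (PrimeSpectrum.comap (algebraMap A R)) fun p q h =>
    Ideal.IsIntegral.comap_lt_comap (R := A) (I := p.asIdeal) (J := q.asIdeal) h

theorem ringKrullDim_localization_le {R : Type*} [CommRing R] (p : Ideal R) [hp : p.IsPrime] :
    ringKrullDim (Localization.AtPrime p) ≤ ringKrullDim R := by
  rw [IsLocalization.AtPrime.ringKrullDim_eq_height p]
  exact Ideal.height_le_ringKrullDim_of_ne_top hp.ne_top

theorem length_le_ringKrullDim_of_isRegular {R : Type*} [CommRing R] [IsNoetherianRing R]
    [IsLocalRing R] {rs : List R} (h : IsRegular R rs) : (rs.length : WithBot ℕ∞) ≤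
      ringKrullDim R := by
  have hne : Ideal.ofList rs ≠ ⊤ := by
    have := h.2
    simpa [eq_comm] using this
  have : Nontrivial (R ⧸ Ideal.ofList rs) := Ideal.Quotient.nontrivial_iff.mpr hne
  have h0 : (0 : WithBot ℕ∞) ≤ ringKrullDim (R ⧸ Ideal.ofList rs) :=
    ringKrullDim_nonneg_of_nontrivial
  rw [← ringKrullDim_add_length_eq_ringKrullDim_of_isRegular rs h]
  exact le_add_of_nonneg_left h0

theorem depthOf_le_of_length_le {R : Type*} [CommRing R] {J : Ideal R} {n : ℕ∞}
    (h : ∀ rs : List R, IsRegular R rs → (rs.length : ℕ∞) ≤ n) : depthOf J ≤ n :=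
  iSup₂_le fun rs hrs => h rs hrs.2

theorem length_le_depthOf {R : Type*} [CommRing R] {J : Ideal R} {rs : List R}
    (hJ : ∀ r ∈ rs, r ∈ J) (h : IsRegular R rs) : (rs.length : ℕ∞) ≤ depthOf J :=
  le_iSup₂ (f := fun (rs : List R) (_ : (∀ r ∈ rs, r ∈ J) ∧ IsRegular R rs) => (rs.length : ℕ∞))
    rs ⟨hJ, h⟩

/-- A regular sequence generates a proper ideal, hence lies in a maximal ideal m and stays regular
in the local ring at m, where the dimension bounds its length. -/
theorem length_le_of_isRegular_of_localization {R : Type*} [CommRing R] {n : ℕ∞}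
    [IsNoetherianRing R] (hdim : ringKrullDim R ≤ n) {rs : List R} (h : IsRegular R rs) :
    (rs.length : ℕ∞) ≤ n := by
  have hne : Ideal.ofList rs ≠ ⊤ := by
    have := h.2
    simpa [eq_comm] using this
  obtain ⟨m, hm, hle⟩ := Ideal.exists_le_maximal _ hne
  have hreg := h.1.isRegular_of_isLocalization_of_mem (Localization.AtPrime m) m
    fun r hr => hle (Ideal.subset_span hr)
  have := (length_le_ringKrullDim_of_isRegular hreg).trans
    ((ringKrullDim_localization_le m).trans hdim)
  rw [List.length_map] at this
  exact_mod_cast this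

/-- Every element of a finite type algebra over a field is, modulo a maximal ideal, a root of
a nonzero polynomial. -/
theorem exists_aeval_mem_of_isMaximal {K R : Type*} [Field K] [CommRing R] [Algebra K R]
    [Algebra.FiniteType K R] (m : Ideal R) [hm : m.IsMaximal] (x : R) :
    ∃ p : Polynomial K, p ≠ 0 ∧ Polynomial.aeval x p ∈ m := by
  let _ := Ideal.Quotient.field m
  have : Module.Finite K (R ⧸ m) := finite_of_finite_type_of_isJacobsonRing K (R ⧸ m)
  obtain ⟨p, hp, h⟩ := Algebra.IsIntegral.isIntegral (R := K) (Ideal.Quotient.mk m x)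
  refine ⟨p, hp.ne_zero, ?_⟩
  rw [← Ideal.Quotient.eq_zero_iff_mem, ← h, ← Ideal.Quotient.mkₐ_eq_mk K m,
    ← Polynomial.aeval_algHom_apply]
  rfl

theorem ringKrullDim_le_two_of_finite (K R : Type*) [Field K] [CommRing R]
    [Algebra (MvPolynomial (Fin 2) K) R] [Module.Finite (MvPolynomial (Fin 2) K) R] :
    ringKrullDim R ≤ (2 : ℕ∞) := by
  refine (ringKrullDim_le_of_isIntegral (MvPolynomial (Fin 2) K) R).trans ?_
  rw [MvPolynomial.ringKrullDim_of_isNoetherianRing, ringKrullDim_eq_zero_of_field]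
  simp

section FiniteFlat

variable {K R : Type*} [Field K] [CommRing R] [Algebra (MvPolynomial (Fin 2) K) R]
  [Module.Finite (MvPolynomial (Fin 2) K) R] [Module.Flat (MvPolynomial (Fin 2) K) R]

theorem isCohenMacaulayRing_of_finite_flat [Algebra K R]
    [IsScalarTower K (MvPolynomial (Fin 2) K) R] : IsCohenMacaulayRing R := by
  have : IsNoetherianRing R := IsNoetherianRing.of_finite (MvPolynomial (Fin 2) K) R
  have : Algebra.FiniteType K R :=
    Algebra.FiniteType.trans (S := MvPolynomial (Fin 2) K) inferInstance inferInstance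
  refine ⟨inferInstance, fun m hm => ?_⟩
  have hdim : ringKrullDim (Localization.AtPrime m) ≤ (2 : ℕ∞) :=
    (ringKrullDim_localization_le m).trans (ringKrullDim_le_two_of_finite K R)
  -- An arbitrary m need not contain the parameters, and K need not be algebraically closed.
  -- Polynomials p(X) and q(Y) with image in m replace X and Y; they are coprime, hence a regular
  -- sequence.
  obtain ⟨p, hp, hpm⟩ := exists_aeval_mem_of_isMaximal (K := K) m
    (algebraMap (MvPolynomial (Fin 2) K) R (X 0))
  obtain ⟨q, hq, hqm⟩ := exists_aeval_mem_of_isMaximal (K := K) m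
    (algebraMap (MvPolynomial (Fin 2) K) R (X 1))
  have hreg := (((isWeaklyRegular_pair_of_isRelPrime (aeval_X_ne_zero hp 0)
    (isRelPrime_aeval_X hp hq)).of_flat (S := R)).isRegular_of_isLocalization_of_mem
    (Localization.AtPrime m) m (by
      intro r hr
      simp only [List.map_cons, List.map_nil, List.mem_cons, List.not_mem_nil, or_false] at hr
      rcases hr with rfl | rfl
      · rwa [← Polynomial.aeval_algebraMap_apply]
      · rwa [← Polynomial.aeval_algebraMap_apply]))
  have h2 := length_le_depthOf (J := IsLocalRing.maximalIdeal (Localization.AtPrime m))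
    (fun r hr => (IsLocalRing.mem_maximalIdeal r).mpr fun hu => by
      have h1 := hreg.2
      apply h1
      have : Ideal.ofList _ = ⊤ := Ideal.eq_top_of_isUnit_mem _ (Ideal.subset_span hr) hu
      rw [this]
      simp) hreg
  have h3 : depthOf (IsLocalRing.maximalIdeal (Localization.AtPrime m)) ≤ 2 :=
    depthOf_le_of_length_le fun rs h => by
      exact_mod_cast (length_le_ringKrullDim_of_isRegular h).trans hdim
  have h4 := length_le_ringKrullDim_of_isRegular hreg
  simp only [List.length_map, List.length_cons, List.length_nil] at h2 h4
  rw [le_antisymm h3 h2]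
  exact le_antisymm (by exact_mod_cast h4) hdim

theorem depthOf_eq_two_of_finite_flat {J : Ideal R} (hJ : J ≠ ⊤)
    (hX : ∀ i, algebraMap (MvPolynomial (Fin 2) K) R (X i) ∈ J) : depthOf J = 2 := by
  have : IsNoetherianRing R := IsNoetherianRing.of_finite (MvPolynomial (Fin 2) K) R
  refine le_antisymm (depthOf_le_of_length_le fun rs h =>
    length_le_of_isRegular_of_localization (ringKrullDim_le_two_of_finite K R) h) ?_
  have hw : IsWeaklyRegular (MvPolynomial (Fin 2) K)
      ([X 0, X 1] : List (MvPolynomial (Fin 2) K)) := by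
    refine isWeaklyRegular_pair_of_isRelPrime (X_ne_zero (R := K) 0) ?_
    simpa using isRelPrime_aeval_X (K := K) (p := Polynomial.X) (q := Polynomial.X)
      Polynomial.X_ne_zero Polynomial.X_ne_zero
  have hw' := hw.of_flat (S := R)
  have hmem : ∀ r ∈ ([X 0, X 1] : List (MvPolynomial (Fin 2) K)).map
      (algebraMap (MvPolynomial (Fin 2) K) R), r ∈ J := by
    simp [hX]
  have := length_le_depthOf hmem ⟨hw', fun h => hJ (top_le_iff.mp (h.le.trans ?_))⟩
  · simpa using this
  · simp [hX]

end FiniteFlat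

/-- If `R` is free over `K[θ₁, θ₂]` with basis `1, e₁, e₂`, then it is Cohen–Macaulay of depth
two with respect to every proper ideal containing the parameters `θ₁, θ₂`. -/
theorem isCohenMacaulayRing_and_depthOf_eq_two {K R : Type*} [Field K] [CommRing R] [Algebra K R]
    (θ : Fin 2 → R) (e₁ e₂ : R)
    (hspan : ∀ r : R, ∃ p q s : MvPolynomial (Fin 2) K,
      r = aeval θ p + aeval θ q * e₁ + aeval θ s * e₂)
    (hind : ∀ p q s : MvPolynomial (Fin 2) K,
      aeval θ p + aeval θ q * e₁ + aeval θ s * e₂ = 0 → p = 0 ∧ q = 0 ∧ s = 0)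
    {J : Ideal R} (hJ : J ≠ ⊤) (hθ : ∀ i, θ i ∈ J) :
    depthOf J = 2 ∧ IsCohenMacaulayRing R := by
  let _ : Algebra (MvPolynomial (Fin 2) K) R := (aeval θ).toAlgebra
  have hmap : ∀ p, algebraMap (MvPolynomial (Fin 2) K) R p = aeval θ p := fun _ => rfl
  have : IsScalarTower K (MvPolynomial (Fin 2) K) R :=
    IsScalarTower.of_algebraMap_eq fun k => by rw [hmap, algebraMap_eq, aeval_C]
  let b : Module.Basis (Fin 3) (MvPolynomial (Fin 2) K) R := Module.Basis.mk (v := ![1, e₁, e₂])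
    (by
      rw [Fintype.linearIndependent_iff]
      intro g hg
      simp only [Fin.sum_univ_three, Algebra.smul_def, hmap] at hg
      obtain ⟨h0, h1, h2⟩ := hind (g 0) (g 1) (g 2) (by simpa using hg)
      intro i
      fin_cases i <;> assumption)
    (by
      rintro r -
      obtain ⟨p, q, s, rfl⟩ := hspan r
      rw [Submodule.mem_span_range_iff_exists_fun]
      exact ⟨![p, q, s], by simp [Fin.sum_univ_three, Algebra.smul_def, hmap]⟩)
  have : Module.Finite (MvPolynomial (Fin 2) K) R := Module.Finite.of_basis b
  have : Module.Free (MvPolynomial (Fin 2) K) R := Module.Free.of_basis b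
  exact ⟨depthOf_eq_two_of_finite_flat (K := K) hJ fun i => by rw [hmap, aeval_X]; exact hθ i,
    isCohenMacaulayRing_of_finite_flat (K := K)⟩

/-! ### The fiber cone of a monomial ideal as a quotient of a polynomial ring -/

theorem mono_add (K : Type*) [Field K] (u v : ℕ × ℕ) : mono K (u + v) = mono K u * mono K v := by
  simp only [mono, Prod.fst_add, Prod.snd_add, pow_add]
  ring

/-- An exponent vector in `ℕ × ℕ` as a finitely supported function on `Fin 2`. -/
def expFinsupp (v : ℕ × ℕ) : Fin 2 →₀ ℕ :=
  Finsupp.single 0 v.1 + Finsupp.single 1 v.2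

theorem expFinsupp_apply_zero (v : ℕ × ℕ) : expFinsupp v 0 = v.1 := by simp [expFinsupp]

theorem expFinsupp_apply_one (v : ℕ × ℕ) : expFinsupp v 1 = v.2 := by simp [expFinsupp]

theorem expFinsupp_le_iff {u v : ℕ × ℕ} : expFinsupp u ≤ expFinsupp v ↔ u ≤ v := by
  simp only [Finsupp.le_def, Fin.forall_fin_two, expFinsupp_apply_zero, expFinsupp_apply_one,
    Prod.le_def]

theorem expFinsupp_injective : Function.Injective expFinsupp := fun _ _ h =>
  le_antisymm (expFinsupp_le_iff.mp h.le) (expFinsupp_le_iff.mp h.ge)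

theorem mono_eq_monomial (K : Type*) [Field K] (v : ℕ × ℕ) :
    mono K v = monomial (expFinsupp v) 1 := by
  rw [mono, X_pow_eq_monomial, X_pow_eq_monomial, monomial_mul, one_mul, expFinsupp]

theorem mono_mem_gradedMaxIdeal (K : Type*) [Field K] {v : ℕ × ℕ} (hv : v ≠ 0) :
    mono K v ∈ gradedMaxIdeal K := by
  have h0 : (X 0 : MvPolynomial (Fin 2) K) ∈ gradedMaxIdeal K := Ideal.subset_span (by simp)
  have h1 : (X 1 : MvPolynomial (Fin 2) K) ∈ gradedMaxIdeal K := Ideal.subset_span (by simp)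
  rcases Nat.eq_zero_or_pos v.1 with h | h
  · rcases Nat.eq_zero_or_pos v.2 with h' | h'
    · exact absurd (Prod.ext h h') hv
    · exact Ideal.mul_mem_left _ _ (Ideal.pow_mem_of_mem _ h1 _ h')
  · exact Ideal.mul_mem_right _ _ (Ideal.pow_mem_of_mem _ h0 _ h)

theorem sub_C_constantCoeff_mem_gradedMaxIdeal {K : Type*} [Field K]
    (f : MvPolynomial (Fin 2) K) : f - C (constantCoeff f) ∈ gradedMaxIdeal K := by
  induction f using MvPolynomial.induction_on with
  | C a => simp
  | add p q hp hq =>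
    rw [map_add, map_add, add_sub_add_comm]
    exact add_mem hp hq
  | mul_X p i hp =>
    have : (X i : MvPolynomial (Fin 2) K) ∈ gradedMaxIdeal K :=
      Ideal.subset_span (by fin_cases i <;> simp)
    simpa using Ideal.mul_mem_left _ p this

/-- With J = 𝔪 this identifies where relations of the fiber cone live: the degree k part of 𝔪R(I)
sits in 𝔪Iᵏ. -/
theorem coeff_mem_of_mem_map_algebraMap {S : Type*} [CommRing S] {I J : Ideal S}
    {P : reesAlgebra I} (hP : P ∈ J.map (algebraMap S (reesAlgebra I))) (k : ℕ) :
    (P : Polynomial S).coeff k ∈ J * I ^ k := by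
  induction hP using Submodule.span_induction generalizing k with
  | mem x hx =>
    obtain ⟨s, hs, rfl⟩ := hx
    change (Polynomial.C s).coeff k ∈ _
    rw [Polynomial.coeff_C]
    split_ifs with h
    · subst h
      simpa using hs
    · exact zero_mem _
  | zero => simp
  | add x y _ _ hx hy => simpa using add_mem (hx k) (hy k)
  | smul r x _ hx =>
    rw [smul_eq_mul, Subalgebra.coe_mul, Polynomial.coeff_mul]
    refine Ideal.sum_mem _ fun ij hij => ?_
    rw [← Finset.HasAntidiagonal.mem_antidiagonal.mp hij]
    have hr : (r : Polynomial S).coeff ij.1 ∈ I ^ ij.1 := r.2 ij.1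
    have := Ideal.mul_mem_mul hr (hx ij.2)
    rwa [mul_left_comm, ← pow_add] at this

variable {K : Type*} [Field K] {ι : Type*}

/-- The ideal generated by the monomials with the given exponent vectors. -/
def monomialIdeal (K : Type*) [Field K] (e : ι → ℕ × ℕ) : Ideal (MvPolynomial (Fin 2) K) :=
  Ideal.span (Set.range fun i => mono K (e i))

theorem monomialIdeal_pow_le (e : ι → ℕ × ℕ) (k : ℕ) :
    monomialIdeal K e ^ k ≤
      Ideal.span (mono K '' {v | ∃ n : ι →₀ ℕ, n.degree = k ∧ Finsupp.weight e n = v}) := by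
  induction k with
  | zero =>
    rw [pow_zero, Ideal.one_eq_top, top_le_iff, Ideal.eq_top_iff_one]
    exact Ideal.subset_span ⟨0, ⟨0, by simp, by simp⟩, by simp [mono]⟩
  | succ k ih =>
    rw [pow_succ]
    refine (Ideal.mul_mono_left ih).trans ?_
    rw [monomialIdeal, Ideal.span_mul_span', Ideal.span_le]
    rintro _ ⟨_, ⟨_, ⟨n, hn, rfl⟩, rfl⟩, _, ⟨i, rfl⟩, rfl⟩
    refine Ideal.subset_span ⟨_, ⟨n + Finsupp.single i 1, ?_, rfl⟩, ?_⟩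
    · rw [map_add, hn, Finsupp.degree_single]
    · rw [map_add, Finsupp.weight_single, one_smul, mono_add]

/-- Every monomial occurring in an element of 𝔪Iᵏ is divisible by a variable times a product of k
generators, so it lies strictly above that product and cannot be minimal. -/
theorem coeff_eq_zero_of_mem_gradedMaxIdeal_mul {e : ι → ℕ × ℕ} {k : ℕ} {v : ℕ × ℕ}
    (hv : ∀ n : ι →₀ ℕ, n.degree = k → Finsupp.weight e n ≤ v → Finsupp.weight e n = v)
    {f : MvPolynomial (Fin 2) K} (hf : f ∈ gradedMaxIdeal K * monomialIdeal K e ^ k) :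
    coeff (expFinsupp v) f = 0 := by
  have hle : gradedMaxIdeal K * monomialIdeal K e ^ k ≤ Ideal.span ((fun s => monomial s (1 : K)) ''
      {s | ∃ n : ι →₀ ℕ, n.degree = k ∧ ∃ j, s = Finsupp.single j 1 +
        expFinsupp (Finsupp.weight e n)}) := by
    refine (Ideal.mul_mono_right (monomialIdeal_pow_le e k)).trans ?_
    rw [gradedMaxIdeal, Ideal.span_mul_span', Ideal.span_le]
    rintro _ ⟨g, hg, _, ⟨_, ⟨n, hn, rfl⟩, rfl⟩, rfl⟩
    have : ∃ j, g = X j := by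
      rcases hg with rfl | rfl
      · exact ⟨0, rfl⟩
      · exact ⟨1, rfl⟩
    obtain ⟨j, rfl⟩ := this
    refine Ideal.subset_span ⟨_, ⟨n, hn, j, rfl⟩, ?_⟩
    simp only [mono_eq_monomial, X, monomial_mul, one_mul]
  by_contra hne
  obtain ⟨s, ⟨n, hn, j, rfl⟩, hs⟩ := mem_ideal_span_monomial_image.mp (hle hf) (expFinsupp v)
    (mem_support_iff.mpr hne)
  have h1 : expFinsupp (Finsupp.weight e n) ≤ expFinsupp v := le_trans le_add_self hs
  rw [hv n hn (expFinsupp_le_iff.mp h1)] at hs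
  have := hs j
  simp at this

/-- The element `f T` of the Rees algebra for a generator `f` of the ideal. -/
def reesGen (K : Type*) [Field K] (e : ι → ℕ × ℕ) (i : ι) : reesAlgebra (monomialIdeal K e) :=
  ⟨Polynomial.monomial 1 (mono K (e i)), reesAlgebra.monomial_mem.mpr (by
    rw [pow_one]
    exact Ideal.subset_span ⟨i, rfl⟩)⟩

/-- The `K`-algebra structure of the fiber cone over its ring structure. -/
instance fiberConeAlgebra (I : Ideal (MvPolynomial (Fin 2) K)) :
    @Algebra K (fiberCone I) _ CommRing.toCommSemiring.toSemiring :=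
  inferInstance

/-- The class of a generator of the ideal in degree one of the fiber cone. -/
def fiberGen (K : Type*) [Field K] (e : ι → ℕ × ℕ) (i : ι) : fiberCone (monomialIdeal K e) :=
  Ideal.Quotient.mk _ (reesGen K e i)

theorem aeval_fiberGen_eq_mk (e : ι → ℕ × ℕ) (P : MvPolynomial ι K) :
    aeval (fiberGen K e) P = Ideal.Quotient.mk _ (aeval (reesGen K e) P) := by
  induction P using MvPolynomial.induction_on with
  | C a =>
    rw [aeval_C, aeval_C]
    rfl
  | add p q hp hq => rw [map_add, map_add, map_add, hp, hq]
  | mul_X p i hp => rw [map_mul, map_mul, map_mul, hp, aeval_X, aeval_X, fiberGen]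

theorem coe_aeval_reesGen (e : ι → ℕ × ℕ) (P : MvPolynomial ι K) :
    (aeval (reesGen K e) P : Polynomial (MvPolynomial (Fin 2) K)) =
      aeval (fun i => Polynomial.monomial 1 (mono K (e i))) P := by
  have := MvPolynomial.comp_aeval_apply (reesGen K e)
    ((reesAlgebra (monomialIdeal K e)).val.restrictScalars K) P
  exact this

theorem finsuppProd_monomial_mono (e : ι → ℕ × ℕ) (n : ι →₀ ℕ) :
    (n.prod fun i k => (Polynomial.monomial 1 (mono K (e i))) ^ k) =
      Polynomial.monomial n.degree (mono K (Finsupp.weight e n)) := by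
  induction n using Finsupp.induction_linear with
  | zero => simp [mono]
  | add n n' hn hn' =>
    rw [Finsupp.prod_add_index' (by simp) (fun _ _ _ => pow_add _ _ _), hn, hn',
      Polynomial.monomial_mul_monomial, map_add, map_add, mono_add]
  | single i k =>
    rw [Finsupp.prod_single_index (by exact pow_zero _), Polynomial.monomial_pow,
      Finsupp.degree_single,
      Finsupp.weight_single, one_mul]
    congr 1
    rw [mono, mono, mul_pow, ← pow_mul, ← pow_mul]
    simp [mul_comm]

theorem coeff_coeff_aeval_reesGen (e : ι → ℕ × ℕ) (P : MvPolynomial ι K) (k : ℕ) (v : ℕ × ℕ) :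
    coeff (expFinsupp v)
        ((aeval (reesGen K e) P : Polynomial (MvPolynomial (Fin 2) K)).coeff k) =
      ∑ n ∈ P.support, if n.degree = k ∧ Finsupp.weight e n = v then coeff n P else 0 := by
  rw [coe_aeval_reesGen]
  conv_lhs => rw [P.as_sum]
  rw [map_sum, Polynomial.finsetSum_coeff, coeff_sum]
  refine Finset.sum_congr rfl fun n _ => ?_
  rw [aeval_monomial, finsuppProd_monomial_mono, IsScalarTower.algebraMap_apply K
    (MvPolynomial (Fin 2) K) (Polynomial _), Polynomial.algebraMap_apply, Algebra.algebraMap_self,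
    RingHom.id_apply, Polynomial.C_mul_monomial, Polynomial.coeff_monomial, mono_eq_monomial]
  by_cases h : n.degree = k
  · rw [if_pos h, algebraMap_eq, C_mul_monomial, coeff_monomial, mul_one]
    simp only [h, true_and, expFinsupp_injective.eq_iff]
  · simp [h]

/-- The coefficients of a polynomial relation between the generators of the fiber cone vanish at
the monomials whose exponent vector is minimal among the products of the same number of
generators and is attained only once in the relation. -/
theorem coeff_eq_zero_of_aeval_fiberGen_eq_zero {e : ι → ℕ × ℕ} {P : MvPolynomial ι K}
    (hP : aeval (fiberGen K e) P = 0) {n : ι →₀ ℕ}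
    (huniq : ∀ n' ∈ P.support, n'.degree = n.degree →
      Finsupp.weight e n' = Finsupp.weight e n → n' = n)
    (hmin : ∀ n' : ι →₀ ℕ, n'.degree = n.degree →
      Finsupp.weight e n' ≤ Finsupp.weight e n → Finsupp.weight e n' = Finsupp.weight e n) :
    coeff n P = 0 := by
  rw [aeval_fiberGen_eq_mk, Ideal.Quotient.eq_zero_iff_mem] at hP
  have h := coeff_eq_zero_of_mem_gradedMaxIdeal_mul hmin
    (coeff_mem_of_mem_map_algebraMap hP n.degree)
  rw [coeff_coeff_aeval_reesGen] at h
  by_contra hne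
  rw [Finset.sum_eq_single n] at h
  · simp [hne] at h
  · intro n' hn' hne'
    rw [if_neg]
    exact fun hh => hne' (huniq n' hn' hh.1 hh.2)
  · intro hn
    simp [notMem_support_iff.mp hn]

theorem fiberGen_mul_fiberGen_eq {e : ι → ℕ × ℕ} {i j k l : ι} (h : e k + e l = e i + e j) :
    fiberGen K e i * fiberGen K e j = fiberGen K e k * fiberGen K e l := by
  rw [fiberGen, fiberGen, fiberGen, fiberGen, ← map_mul, ← map_mul]
  refine congrArg _ (Subtype.ext ?_)
  simp only [reesGen, Subalgebra.coe_mul, Polynomial.monomial_mul_monomial, ← mono_add, h]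

/-- The quotient of the two products is a nonconstant monomial, which lies in 𝔪. -/
theorem fiberGen_mul_fiberGen_eq_zero {e : ι → ℕ × ℕ} {i j k l : ι} (h : e k + e l < e i + e j) :
    fiberGen K e i * fiberGen K e j = 0 := by
  obtain ⟨d, hd⟩ := exists_add_of_le h.le
  have hd0 : d ≠ 0 := by
    rintro rfl
    exact h.ne (by rw [hd, add_zero])
  have : reesGen K e i * reesGen K e j =
      algebraMap _ _ (mono K d) * (reesGen K e k * reesGen K e l) := by
    ext1
    change Polynomial.monomial 1 _ * Polynomial.monomial 1 _ =
      Polynomial.C _ * (Polynomial.monomial 1 _ * Polynomial.monomial 1 _)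
    rw [Polynomial.monomial_mul_monomial, Polynomial.monomial_mul_monomial,
      Polynomial.C_mul_monomial, ← mono_add, ← mono_add, ← mono_add, hd, add_comm d]
  rw [fiberGen, fiberGen, ← map_mul, Ideal.Quotient.eq_zero_iff_mem, this]
  exact Ideal.mul_mem_right _ _ (Ideal.mem_map_of_mem _ (mono_mem_gradedMaxIdeal K hd0))

theorem mk_algebraMap_eq (I : Ideal (MvPolynomial (Fin 2) K)) (f : MvPolynomial (Fin 2) K) :
    algebraMap (MvPolynomial (Fin 2) K) (fiberCone I) f =
      algebraMap K (fiberCone I) (constantCoeff f) := by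
  rw [IsScalarTower.algebraMap_apply K (MvPolynomial (Fin 2) K) (fiberCone I), ← sub_eq_zero,
    ← map_sub]
  exact Ideal.Quotient.eq_zero_iff_mem.mpr
    (Ideal.mem_map_of_mem _ (sub_C_constantCoeff_mem_gradedMaxIdeal f))

/-- The Rees ring is generated over S by the elements fT with f ∈ I, and modulo 𝔪 the coefficients
from S reduce to their constant terms. -/
theorem aeval_fiberGen_surjective (e : ι → ℕ × ℕ) :
    Function.Surjective (aeval (R := K) (fiberGen K e)) := by
  have key : ∀ (P : Polynomial (MvPolynomial (Fin 2) K)) (hP : P ∈ reesAlgebra (monomialIdeal K e)),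
      (Ideal.Quotient.mk _ ⟨P, hP⟩ : fiberCone (monomialIdeal K e)) ∈
        (aeval (R := K) (fiberGen K e)).range := by
    intro P hP
    have hP' := hP
    rw [← adjoin_monomial_eq_reesAlgebra] at hP'
    induction hP' using Algebra.adjoin_induction with
    | mem x hx =>
      obtain ⟨f, hf, rfl⟩ := hx
      have hf' := hf
      change f ∈ monomialIdeal K e at hf'
      induction hf' using Submodule.span_induction with
      | mem g hg =>
        obtain ⟨i, rfl⟩ := hg
        exact ⟨X i, aeval_X _ _⟩
      | zero =>
        convert zero_mem (aeval (R := K) (fiberGen K e)).range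
        have h0 : (⟨Polynomial.monomial 1 0, hP⟩ : reesAlgebra (monomialIdeal K e)) = 0 := by
          ext1
          simp
        rw [h0, map_zero]
      | add f g hf' hg' ihf ihg =>
        have h1 := add_mem (ihf hf' (reesAlgebra.monomial_mem.mpr (by rwa [pow_one])))
          (ihg hg' (reesAlgebra.monomial_mem.mpr (by rwa [pow_one])))
        rw [← map_add] at h1
        convert h1 using 2
        ext1
        simp
      | smul r f hf' ihf =>
        have h1 := mul_mem (Subalgebra.algebraMap_mem (aeval (R := K) (fiberGen K e)).range
          (constantCoeff r)) (ihf hf' (reesAlgebra.monomial_mem.mpr (by rwa [pow_one])))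
        rw [← mk_algebraMap_eq] at h1
        convert h1 using 1
        change _ = Ideal.Quotient.mk _ (algebraMap _ _ r) * _
        rw [← map_mul]
        exact congrArg _ (Subtype.ext (Polynomial.C_mul_monomial (n := 1)).symm)
    | algebraMap r =>
      have h1 := Subalgebra.algebraMap_mem (aeval (R := K) (fiberGen K e)).range
          (constantCoeff r)
      rw [← mk_algebraMap_eq] at h1
      exact h1
    | add x y hx hy ihx ihy =>
      rw [adjoin_monomial_eq_reesAlgebra] at hx hy
      exact add_mem (ihx hx) (ihy hy)
    | mul x y hx hy ihx ihy =>
      rw [adjoin_monomial_eq_reesAlgebra] at hx hy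
      exact mul_mem (ihx hx) (ihy hy)
  intro y
  obtain ⟨⟨P, hP⟩, rfl⟩ := Ideal.Quotient.mk_surjective y
  exact key P hP

theorem fiberGen_mem_fiberConeIrrelevant (e : ι → ℕ × ℕ) (i : ι) :
    fiberGen K e i ∈ fiberConeIrrelevant (monomialIdeal K e) := by
  refine Ideal.mem_map_of_mem _ ?_
  change Polynomial.constantCoeff (Polynomial.monomial 1 _) = 0
  simp

theorem fiberConeIrrelevant_ne_top (I : Ideal (MvPolynomial (Fin 2) K)) :
    fiberConeIrrelevant I ≠ ⊤ := by
  -- The constant term of the degree zero component is a ring map to K that kills both 𝔪R(I) and the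
  -- irrelevant ideal.
  let χ : reesAlgebra I →+* K := (constantCoeff (R := K) (σ := Fin 2)).comp
    ((Polynomial.constantCoeff (R := MvPolynomial (Fin 2) K)).comp
      (reesAlgebra I).val.toRingHom)
  have h1 : (gradedMaxIdeal K).map (algebraMap (MvPolynomial (Fin 2) K) (reesAlgebra I)) ≤
      RingHom.ker χ := by
    rw [gradedMaxIdeal, Ideal.map_span, Ideal.span_le]
    rintro _ ⟨f, hf, rfl⟩
    change constantCoeff (Polynomial.constantCoeff (Polynomial.C f)) = 0
    rcases hf with rfl | rfl <;> simp
  let ψ : fiberCone I →+* K := Ideal.Quotient.lift _ χ fun x hx => h1 hx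
  have h2 : fiberConeIrrelevant I ≤ RingHom.ker ψ := by
    rw [fiberConeIrrelevant, Ideal.map_le_iff_le_comap]
    intro x hx
    change constantCoeff (Polynomial.constantCoeff (x : Polynomial (MvPolynomial (Fin 2) K))) = 0
    have hx' : Polynomial.constantCoeff (x : Polynomial (MvPolynomial (Fin 2) K)) = 0 := hx
    rw [hx', map_zero]
  exact fun h => RingHom.ker_ne_top ψ (top_le_iff.mp (h ▸ h2))

/-! ### Free bases of the fiber cone of a symmetric ideal -/

/-- The three product hypotheses make the K[θ]-span of 1, e₁, e₂ closed under multiplication;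
containing all tᵢ, it is everything. -/
theorem forall_mem_span_one_pair {K R : Type*} [Field K] [CommRing R] [Algebra K R] {ι : Type*}
    {t : ι → R} (ht : Function.Surjective (aeval (R := K) t)) (θ : Fin 2 → R) {e₁ e₂ : R}
    (hgen : ∀ i, ∃ p q s : MvPolynomial (Fin 2) K,
      t i = aeval θ p + aeval θ q * e₁ + aeval θ s * e₂)
    (h₁₁ : ∃ p q s : MvPolynomial (Fin 2) K,
      e₁ * e₁ = aeval θ p + aeval θ q * e₁ + aeval θ s * e₂)
    (h₁₂ : ∃ p q s : MvPolynomial (Fin 2) K,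
      e₁ * e₂ = aeval θ p + aeval θ q * e₁ + aeval θ s * e₂)
    (h₂₂ : ∃ p q s : MvPolynomial (Fin 2) K,
      e₂ * e₂ = aeval θ p + aeval θ q * e₁ + aeval θ s * e₂) (r : R) :
    ∃ p q s : MvPolynomial (Fin 2) K, r = aeval θ p + aeval θ q * e₁ + aeval θ s * e₂ := by
  obtain ⟨P, rfl⟩ := ht r
  induction P using MvPolynomial.induction_on with
  | C k => exact ⟨C k, 0, 0, by simp⟩
  | add P Q hP hQ =>
    obtain ⟨p, q, s, h⟩ := hP
    obtain ⟨p', q', s', h'⟩ := hQ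
    refine ⟨p + p', q + q', s + s', ?_⟩
    rw [map_add, h, h']
    simp only [map_add]
    ring
  | mul_X P i hP =>
    obtain ⟨p, q, s, h⟩ := hP
    obtain ⟨p', q', s', h'⟩ := hgen i
    obtain ⟨a₀, a₁, a₂, ha⟩ := h₁₁
    obtain ⟨b₀, b₁, b₂, hb⟩ := h₁₂
    obtain ⟨c₀, c₁, c₂, hc⟩ := h₂₂
    refine ⟨p * p' + q * q' * a₀ + (q * s' + s * q') * b₀ + s * s' * c₀,
      p * q' + q * p' + q * q' * a₁ + (q * s' + s * q') * b₁ + s * s' * c₁,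
      p * s' + s * p' + q * q' * a₂ + (q * s' + s * q') * b₂ + s * s' * c₂, ?_⟩
    rw [map_mul, aeval_X, h, h']
    simp only [map_add, map_mul]
    linear_combination (aeval θ q * aeval θ q') * ha +
      (aeval θ q * aeval θ s' + aeval θ s * aeval θ q') * hb + (aeval θ s * aeval θ s') * hc

theorem coeff_killCompl {K σ τ : Type*} [CommSemiring K] {f : σ → τ} (hf : Function.Injective f)
    (P : MvPolynomial τ K) (m : σ →₀ ℕ) :
    coeff m (killCompl hf P) = coeff (m.mapDomain f) P := by
  classical
  induction P using MvPolynomial.induction_on' with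
  | monomial s k =>
    by_cases hs : (s.support : Set τ) ⊆ Set.range f
    · obtain ⟨u, rfl⟩ : ∃ u : σ →₀ ℕ, u.mapDomain f = s :=
        ⟨s.comapDomain f hf.injOn, Finsupp.mapDomain_comapDomain f hf s hs⟩
      rw [killCompl_monomial_mapDomain, coeff_monomial, coeff_monomial]
      simp only [(Finsupp.mapDomain_injective hf).eq_iff]
    · rw [killCompl_monomial_eq_zero_of_not_subset hf k hs, coeff_zero, coeff_monomial, if_neg]
      rintro rfl
      apply hs
      intro i hi
      by_contra hi'
      exact Finsupp.mem_support_iff.mp hi (Finsupp.mapDomain_of_notMem_range _ _ hi')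
  | add p q hp hq => rw [map_add, coeff_add, coeff_add, hp, hq]

/-- The exponent vectors of the generators of the ideal `(x^c, x^b y^a, x^a y^b, y^c)`. -/
def symExp (a b c : ℕ) : Fin 4 → ℕ × ℕ :=
  ![(c, 0), (b, a), (a, b), (0, c)]

theorem degree_fin_four (n : Fin 4 →₀ ℕ) : n.degree = n 0 + n 1 + n 2 + n 3 := by
  rw [Finsupp.degree_eq_sum, Fin.sum_univ_four]

theorem weight_symExp (a b c : ℕ) (n : Fin 4 →₀ ℕ) : Finsupp.weight (symExp a b c) n =
    (n 0 * c + n 1 * b + n 2 * a, n 1 * a + n 2 * b + n 3 * c) := by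
  rw [Finsupp.weight_apply, Finsupp.sum_fintype _ _ (by simp), Fin.sum_univ_four]
  simp [symExp]

theorem finsupp_fin_four_ext {n n' : Fin 4 →₀ ℕ} (h0 : n' 0 = n 0) (h1 : n' 1 = n 1)
    (h2 : n' 2 = n 2) (h3 : n' 3 = n 3) : n' = n := by
  ext i
  fin_cases i <;> assumption

theorem eq_zero_and_eq_zero_of_mul_add_mul_nonpos {x y : ℕ} {k l : ℤ} (hk : 0 < k) (hl : 0 < l)
    (h : x * k + y * l ≤ 0) : x = 0 ∧ y = 0 := by
  have hx : 0 ≤ (x : ℤ) * k := by positivity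
  have hy : 0 ≤ (y : ℤ) * l := by positivity
  have hx' : (x : ℤ) * k = 0 := by linarith
  have hy' : (y : ℤ) * l = 0 := by linarith
  simpa [hk.ne', hl.ne'] using And.intro hx' hy'

/-! ### Unique minimal exponent vectors along the edges of the Newton polygon, for a + b < c. -/

section Convex

variable {a b c : ℕ} (ha : 0 < a) (hab : a < b) (hc : a + b < c) {n n' : Fin 4 →₀ ℕ}
  (hd : n'.degree = n.degree)
  (hw : Finsupp.weight (symExp a b c) n' ≤ Finsupp.weight (symExp a b c) n)

include ha hab hc hd hw

/-- The functional ax + (c − b)y supports the edge from (c, 0) to (b, a): it equals ac there and is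
larger at the other two generators. So no smaller or equal sum can use those two, and on the edge
the coordinates decide. -/
theorem eq_of_weight_le_of_mem_left_facet (hn2 : n 2 = 0) (hn3 : n 3 = 0) : n' = n := by
  rw [weight_symExp, weight_symExp, Prod.mk_le_mk] at hw
  rw [degree_fin_four, degree_fin_four] at hd
  obtain ⟨hx, hy⟩ := hw
  simp only [hn2, hn3, zero_mul, add_zero] at hx hy hd
  obtain ⟨hr, hs⟩ : n' 2 = 0 ∧ n' 3 = 0 := by
    zify at ha hab hc hx hy hd
    -- `k` and `l` are the excesses over ac of the functional at (a, b) and (0, c).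
    refine eq_zero_and_eq_zero_of_mul_add_mul_nonpos (k := (b - a) * (c - a - b))
      (l := c * (c - b - a)) (mul_pos (by linarith) (by linarith))
      (mul_pos (by linarith) (by linarith)) ?_
    have h1 := mul_le_mul_of_nonneg_left hx ha.le
    have h2 := mul_le_mul_of_nonneg_left hy (show (0 : ℤ) ≤ c - b by linarith)
    have h3 := congrArg (fun z : ℤ => a * c * z) hd
    linarith
  simp only [hr, hs, zero_mul, add_zero] at hx hy hd
  have h1 : n' 1 ≤ n 1 := le_of_mul_le_mul_right (by linarith) ha
  have h2 : n 1 ≤ n' 1 := by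
    zify at ha hab hc hx hy hd ⊢
    refine le_of_mul_le_mul_right (a := (c - b : ℤ)) ?_ (by linarith)
    have h3 := congrArg (fun z : ℤ => c * z) hd
    linarith
  exact finsupp_fin_four_ext (by omega) (by omega) (by omega) (by omega)

theorem eq_of_weight_le_of_mem_right_facet (hn0 : n 0 = 0) (hn1 : n 1 = 0) : n' = n := by
  rw [weight_symExp, weight_symExp, Prod.mk_le_mk] at hw
  rw [degree_fin_four, degree_fin_four] at hd
  obtain ⟨hx, hy⟩ := hw
  simp only [hn0, hn1, zero_mul, add_zero, zero_add] at hx hy hd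
  obtain ⟨hr, hs⟩ : n' 1 = 0 ∧ n' 0 = 0 := by
    zify at ha hab hc hx hy hd
    refine eq_zero_and_eq_zero_of_mul_add_mul_nonpos (k := (b - a) * (c - a - b))
      (l := c * (c - b - a)) (mul_pos (by linarith) (by linarith))
      (mul_pos (by linarith) (by linarith)) ?_
    have h1 := mul_le_mul_of_nonneg_left hy ha.le
    have h2 := mul_le_mul_of_nonneg_left hx (show (0 : ℤ) ≤ c - b by linarith)
    have h3 := congrArg (fun z : ℤ => a * c * z) hd
    linarith
  simp only [hr, hs, zero_mul, add_zero, zero_add] at hx hy hd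
  have h1 : n' 2 ≤ n 2 := le_of_mul_le_mul_right (by linarith) ha
  have h2 : n 2 ≤ n' 2 := by
    zify at ha hab hc hx hy hd ⊢
    refine le_of_mul_le_mul_right (a := (c - b : ℤ)) ?_ (by linarith)
    have h3 := congrArg (fun z : ℤ => c * z) hd
    linarith
  exact finsupp_fin_four_ext (by omega) (by omega) (by omega) (by omega)

omit ha in
theorem eq_of_weight_le_of_mem_middle_facet (hn0 : n 0 = 0) (hn3 : n 3 = 0) : n' = n := by
  rw [weight_symExp, weight_symExp, Prod.mk_le_mk] at hw
  rw [degree_fin_four, degree_fin_four] at hd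
  obtain ⟨hx, hy⟩ := hw
  simp only [hn0, hn3, zero_mul, add_zero, zero_add] at hx hy hd
  obtain ⟨hr, hs⟩ : n' 0 = 0 ∧ n' 3 = 0 := by
    zify at hab hc hx hy hd
    -- Here the supporting functional is x + y, equal to a + b on the middle edge and to c at both
    -- endpoints.
    refine eq_zero_and_eq_zero_of_mul_add_mul_nonpos (k := c - a - b)
      (l := c - a - b) (by linarith) (by linarith) ?_
    have h3 := congrArg (fun z : ℤ => (a + b) * z) hd
    linarith
  simp only [hr, hs, zero_mul, add_zero, zero_add] at hx hy hd
  zify at hab hx hy hd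
  have h1 : (n' 1 : ℤ) ≤ n 1 := by
    refine le_of_mul_le_mul_right (a := (b - a : ℤ)) ?_ (by linarith)
    have h3 := congrArg (fun z : ℤ => a * z) hd
    linarith
  have h2 : (n 1 : ℤ) ≤ n' 1 := by
    refine le_of_mul_le_mul_right (a := (b - a : ℤ)) ?_ (by linarith)
    have h3 := congrArg (fun z : ℤ => b * z) hd
    linarith
  exact finsupp_fin_four_ext (by omega) (by omega) (by omega) (by omega)

end Convex

/-! ### The case a + b < c: restriction to the edges of a path. -/

theorem killCompl_eq_zero_of_aeval_fiberGen_eq_zero {K : Type*} [Field K] {σ ι : Type*}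
    {e : ι → ℕ × ℕ} {f : σ → ι} (hf : Function.Injective f)
    (hmin : ∀ n n' : ι →₀ ℕ, (∀ i ∉ Set.range f, n i = 0) → n'.degree = n.degree →
      Finsupp.weight e n' ≤ Finsupp.weight e n → n' = n)
    {P : MvPolynomial ι K} (hP : aeval (fiberGen K e) P = 0) : killCompl hf P = 0 := by
  ext m
  rw [coeff_killCompl, coeff_zero]
  have hm : ∀ i ∉ Set.range f, m.mapDomain f i = 0 := fun i hi =>
    Finsupp.mapDomain_of_notMem_range _ _ hi
  exact coeff_eq_zero_of_aeval_fiberGen_eq_zero hP (fun n' _ h1 h2 => hmin _ _ hm h1 h2.le)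
    fun n' h1 h2 => congrArg _ (hmin _ _ hm h1 h2)

theorem killCompl_X_apply {K σ τ : Type*} [CommSemiring K] {f : σ → τ}
    (hf : Function.Injective f) (i : σ) :
    killCompl hf (X (f i) : MvPolynomial τ K) = X i := by
  rw [← rename_X f i, killCompl_rename_app]

theorem killCompl_X_of_notMem_range {K σ τ : Type*} [CommSemiring K] {f : σ → τ}
    (hf : Function.Injective f) {j : τ} (hj : j ∉ Set.range f) :
    killCompl hf (X j : MvPolynomial τ K) = 0 := by
  rw [killCompl, aeval_X, dif_neg hj]

/-- The order 2, 1 makes T₀ + T₂ restrict to X₀ and T₁ + T₃ to X₁ on the middle edge, as on the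
other two. -/
theorem injective_two_one : Function.Injective (![2, 1] : Fin 2 → Fin 4) := by decide

theorem injective_zero_one : Function.Injective (![0, 1] : Fin 2 → Fin 4) := by decide

theorem injective_two_three : Function.Injective (![2, 3] : Fin 2 → Fin 4) := by decide

/-- A quotient of `K[T₀, T₁, T₂, T₃]` in which `T₀T₂ = T₁T₃ = T₀T₃ = 0` and which surjects onto the
coordinate rings of the three coordinate planes `(0, 1)`, `(1, 2)` and `(2, 3)` is free over
`K[T₀ + T₂, T₁ + T₃]` with basis `1, T₀, T₃`. -/
theorem isCohenMacaulayRing_and_depthOf_eq_two_of_path {K R : Type*} [Field K] [CommRing R]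
    [Algebra K R] {T : Fin 4 → R} (hT : Function.Surjective (aeval (R := K) T))
    (h02 : T 0 * T 2 = 0) (h13 : T 1 * T 3 = 0) (h03 : T 0 * T 3 = 0)
    (H1 : ∀ P : MvPolynomial (Fin 4) K, aeval T P = 0 → killCompl injective_two_one P = 0)
    (H2 : ∀ P : MvPolynomial (Fin 4) K, aeval T P = 0 → killCompl injective_zero_one P = 0)
    (H3 : ∀ P : MvPolynomial (Fin 4) K, aeval T P = 0 → killCompl injective_two_three P = 0)
    {J : Ideal R} (hJ : J ≠ ⊤) (hmem : ∀ i, T i ∈ J) :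
    depthOf J = 2 ∧ IsCohenMacaulayRing R := by
  let θ' : Fin 2 → MvPolynomial (Fin 4) K := ![X 0 + X 2, X 1 + X 3]
  let θ : Fin 2 → R := fun i => aeval T (θ' i)
  have hθ0 : θ 0 = T 0 + T 2 := by simp [θ, θ']
  have hθ1 : θ 1 = T 1 + T 3 := by simp [θ, θ']
  refine isCohenMacaulayRing_and_depthOf_eq_two (K := K) θ (T 0) (T 3) ?_ ?_ hJ ?_
  -- The witnesses encode T₀² = (T₀ + T₂)T₀, T₀T₃ = 0 and T₃² = (T₁ + T₃)T₃.
  · refine forall_mem_span_one_pair hT θ (fun i => ?_)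
      ⟨0, X 0, 0, ?_⟩ ⟨0, 0, 0, ?_⟩ ⟨0, 0, X 1, ?_⟩
    · fin_cases i
      · exact ⟨0, 1, 0, by simp⟩
      · exact ⟨X 1, 0, -1, by simp [hθ1]⟩
      · exact ⟨X 0, -1, 0, by simp [hθ0]⟩
      · exact ⟨0, 0, 1, by simp⟩
    · simp only [map_zero, aeval_X, hθ0]
      linear_combination -h02
    · simp only [map_zero]
      linear_combination h03
    · simp only [map_zero, aeval_X, hθ1]
      linear_combination -h13
  · intro p q s h
    have hcomp : ∀ r : MvPolynomial (Fin 2) K, aeval θ r = aeval T (aeval θ' r) := fun r =>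
      (MvPolynomial.comp_aeval_apply θ' (aeval T) r).symm
    set P := aeval θ' p + aeval θ' q * X 0 + aeval θ' s * X 3 with hP
    have hPT : aeval T P = 0 := by
      rw [hP, map_add, map_add, map_mul, map_mul, aeval_X, aeval_X, ← hcomp, ← hcomp, ← hcomp]
      exact h
    replace H1 := H1 P hPT
    replace H2 := H2 P hPT
    replace H3 := H3 P hPT
    -- Since the parameters restrict to the two variables on each edge, restriction recovers p, q,
    -- s. The middle edge kills T₀ and T₃ and yields p = 0; the left and right edges then yield qX₀
    -- = 0 and sX₁ = 0.
    have hfacet : ∀ {f : Fin 2 → Fin 4} (hf : Function.Injective f),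
        (∀ i, killCompl hf (θ' i) = X i) → ∀ r, killCompl hf (aeval θ' r) = r := by
      intro f hf hi r
      rw [MvPolynomial.comp_aeval_apply, funext hi, aeval_X_left_apply]
    have X10 : killCompl injective_two_one (X 0 : MvPolynomial (Fin 4) K) = 0 :=
      killCompl_X_of_notMem_range _ (by decide)
    have X11 : killCompl injective_two_one (X 1 : MvPolynomial (Fin 4) K) = X 1 :=
      killCompl_X_apply injective_two_one 1
    have X12 : killCompl injective_two_one (X 2 : MvPolynomial (Fin 4) K) = X 0 :=
      killCompl_X_apply injective_two_one 0
    have X13 : killCompl injective_two_one (X 3 : MvPolynomial (Fin 4) K) = 0 :=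
      killCompl_X_of_notMem_range _ (by decide)
    have X20 : killCompl injective_zero_one (X 0 : MvPolynomial (Fin 4) K) = X 0 :=
      killCompl_X_apply injective_zero_one 0
    have X21 : killCompl injective_zero_one (X 1 : MvPolynomial (Fin 4) K) = X 1 :=
      killCompl_X_apply injective_zero_one 1
    have X22 : killCompl injective_zero_one (X 2 : MvPolynomial (Fin 4) K) = 0 :=
      killCompl_X_of_notMem_range _ (by decide)
    have X23 : killCompl injective_zero_one (X 3 : MvPolynomial (Fin 4) K) = 0 :=
      killCompl_X_of_notMem_range _ (by decide)
    have X30 : killCompl injective_two_three (X 0 : MvPolynomial (Fin 4) K) = 0 :=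
      killCompl_X_of_notMem_range _ (by decide)
    have X31 : killCompl injective_two_three (X 1 : MvPolynomial (Fin 4) K) = 0 :=
      killCompl_X_of_notMem_range _ (by decide)
    have X32 : killCompl injective_two_three (X 2 : MvPolynomial (Fin 4) K) = X 0 :=
      killCompl_X_apply injective_two_three 0
    have X33 : killCompl injective_two_three (X 3 : MvPolynomial (Fin 4) K) = X 1 :=
      killCompl_X_apply injective_two_three 1
    have F1 := hfacet injective_two_one
      (Fin.forall_fin_two.mpr ⟨by simp [θ', X10, X12], by simp [θ', X11, X13]⟩)
    have F2 := hfacet injective_zero_one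
      (Fin.forall_fin_two.mpr ⟨by simp [θ', X20, X22], by simp [θ', X21, X23]⟩)
    have F3 := hfacet injective_two_three
      (Fin.forall_fin_two.mpr ⟨by simp [θ', X30, X32], by simp [θ', X31, X33]⟩)
    rw [hP, map_add, map_add, map_mul, map_mul, F1, F1, F1, X10, X13, mul_zero, mul_zero, add_zero,
      add_zero] at H1
    rw [hP, map_add, map_add, map_mul, map_mul, F2, F2, F2, X20, X23, mul_zero, add_zero, H1,
      zero_add] at H2
    rw [hP, map_add, map_add, map_mul, map_mul, F3, F3, F3, X30, X33, mul_zero, add_zero, H1,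
      zero_add] at H3
    exact ⟨H1, (mul_eq_zero.mp H2).resolve_right (X_ne_zero _),
      (mul_eq_zero.mp H3).resolve_right (X_ne_zero _)⟩
  · refine Fin.forall_fin_two.mpr ⟨?_, ?_⟩
    · rw [hθ0]
      exact add_mem (hmem 0) (hmem 2)
    · rw [hθ1]
      exact add_mem (hmem 1) (hmem 3)

theorem depth_eq_two_and_isCohenMacaulay_of_add_lt (K : Type*) [Field K] {a b c : ℕ} (ha : 0 < a)
    (hab : a < b) (hc : a + b < c) (h₁ : 2 * a ≤ b) (h₂ : 2 * b ≤ a + c) :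
    fiberConeDepth (monomialIdeal K (symExp a b c)) = 2 ∧
      IsCohenMacaulayRing (fiberCone (monomialIdeal K (symExp a b c))) := by
  refine isCohenMacaulayRing_and_depthOf_eq_two_of_path (aeval_fiberGen_surjective (K := K) _)
    (fiberGen_mul_fiberGen_eq_zero (k := 1) (l := 1) ?_)
    (fiberGen_mul_fiberGen_eq_zero (k := 2) (l := 2) ?_)
    (fiberGen_mul_fiberGen_eq_zero (k := 1) (l := 2) ?_)
    (fun P hP => killCompl_eq_zero_of_aeval_fiberGen_eq_zero _ (fun n n' h0 hd hw =>
      eq_of_weight_le_of_mem_middle_facet hab hc hd hw (h0 0 (by decide)) (h0 3 (by decide))) hP)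
    (fun P hP => killCompl_eq_zero_of_aeval_fiberGen_eq_zero _ (fun n n' h0 hd hw =>
      eq_of_weight_le_of_mem_left_facet ha hab hc hd hw (h0 2 (by decide)) (h0 3 (by decide))) hP)
    (fun P hP => killCompl_eq_zero_of_aeval_fiberGen_eq_zero _ (fun n n' h0 hd hw =>
      eq_of_weight_le_of_mem_right_facet ha hab hc hd hw (h0 0 (by decide)) (h0 1 (by decide))) hP)
    (fiberConeIrrelevant_ne_top _) (fiberGen_mem_fiberConeIrrelevant _)
  all_goals
    simp only [symExp, Matrix.cons_val, Prod.lt_iff, Prod.mk_add_mk]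
    omega

/-! ### Comparison of exponent vectors with at most one inner generator, for c ≤ a + b. -/

section Concave

variable {a b c : ℕ} {n n' : Fin 4 →₀ ℕ} (hd : n'.degree = n.degree)

include hd

/-- All four generators lie on the line x + y = 3a, so comparable sums of equal length coincide. -/
theorem weight_eq_of_weight_le_of_eq_mul (hb : b = 2 * a) (hc : c = 3 * a)
    (hw : Finsupp.weight (symExp a b c) n' ≤ Finsupp.weight (symExp a b c) n) :
    Finsupp.weight (symExp a b c) n' = Finsupp.weight (symExp a b c) n := by
  rw [weight_symExp, weight_symExp, Prod.mk_le_mk] at hw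
  rw [degree_fin_four, degree_fin_four] at hd
  rw [weight_symExp, weight_symExp, Prod.mk.injEq]
  have h := congrArg (fun z => 3 * a * z) hd
  subst hb hc
  constructor <;> linarith

theorem eq_of_weight_eq_of_eq_mul (ha : 0 < a) (hb : b = 2 * a) (hc : c = 3 * a)
    (hn : n 1 + n 2 ≤ 1) (hn' : n' 1 + n' 2 ≤ 1)
    (hw : Finsupp.weight (symExp a b c) n' = Finsupp.weight (symExp a b c) n) : n' = n := by
  rw [weight_symExp, weight_symExp, Prod.mk.injEq] at hw
  rw [degree_fin_four, degree_fin_four] at hd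
  subst hb hc
  -- As n₁ + n₂ ≤ 1, the term 2n₁ + n₂ is the remainder modulo 3, so both sides have the same
  -- digits.
  have h : 3 * n' 0 + 2 * n' 1 + n' 2 = 3 * n 0 + 2 * n 1 + n 2 :=
    Nat.eq_of_mul_eq_mul_right ha (by linarith [hw.1])
  exact finsupp_fin_four_ext (by omega) (by omega) (by omega) (by omega)

theorem eq_of_weight_le_of_lt_add (hab : a < b) (hbc : b < c) (hc : c < a + b)
    (hn : n 1 + n 2 ≤ 1)
    (hw : Finsupp.weight (symExp a b c) n' ≤ Finsupp.weight (symExp a b c) n) : n' = n := by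
  rw [weight_symExp, weight_symExp, Prod.mk_le_mk] at hw
  rw [degree_fin_four, degree_fin_four] at hd
  obtain ⟨hx, hy⟩ := hw
  -- Adding the coordinates: inner generators have total degree a + b > c, so n' uses no more of
  -- them than n.
  have h12 : n' 1 + n' 2 ≤ n 1 + n 2 := by
    zify at hx hy hd hc ⊢
    refine le_of_mul_le_mul_right (a := (a + b - c : ℤ)) ?_ (by linarith)
    have h := congrArg (fun z : ℤ => c * z) hd
    linarith
  -- The contribution of the at most one inner generator is below c, so multiples of c can be
  -- compared. With equal degrees all inequalities become equalities, and `hp'`, `hs'` exclude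
  -- exchanging the two inner generators.
  have key : ∀ {p q d : ℕ}, p * c ≤ q * c + d → d < c → p ≤ q := by
    intro p q d h hdc
    refine Nat.lt_succ_iff.mp (lt_of_mul_lt_mul_right (a := c) ?_ (Nat.zero_le _))
    rw [Nat.succ_mul]
    omega
  have key' : ∀ {p q d : ℕ}, p * c + d ≤ q * c → 0 < d → p < q := by
    intro p q d h hd0
    exact lt_of_mul_lt_mul_right (a := c) (by omega) (Nat.zero_le _)
  have hq : (n 1 = 0 ∧ n 2 = 0) ∨ (n 1 = 1 ∧ n 2 = 0) ∨ (n 1 = 0 ∧ n 2 = 1) := by omega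
  have hq' : (n' 1 = 0 ∧ n' 2 = 0) ∨ (n' 1 = 1 ∧ n' 2 = 0) ∨ (n' 1 = 0 ∧ n' 2 = 1) := by omega
  have hp : n' 0 ≤ n 0 := key (d := n 1 * b + n 2 * a) (by lia) (by
    rcases hq with ⟨h1, h2⟩ | ⟨h1, h2⟩ | ⟨h1, h2⟩ <;> rw [h1, h2] <;> omega)
  have hs : n' 3 ≤ n 3 := key (d := n 1 * a + n 2 * b) (by lia) (by
    rcases hq with ⟨h1, h2⟩ | ⟨h1, h2⟩ | ⟨h1, h2⟩ <;> rw [h1, h2] <;> omega)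
  have hp' : n 1 = 0 → n' 1 = 1 → n' 0 < n 0 := fun h1 h1' => by
    have h2 : n 2 ≤ 1 := by omega
    have h3 : n 2 * a ≤ 1 * a := Nat.mul_le_mul_right a h2
    rw [h1, h1'] at hx
    exact key' (d := b - a) (by omega) (by omega)
  have hs' : n 2 = 0 → n' 2 = 1 → n' 3 < n 3 := fun h2 h2' => by
    have h1 : n 1 ≤ 1 := by omega
    have h3 : n 1 * a ≤ 1 * a := Nat.mul_le_mul_right a h1
    rw [h2, h2'] at hy
    exact key' (d := b - a) (by omega) (by omega)
  refine finsupp_fin_four_ext ?_ ?_ ?_ ?_ <;> omega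

end Concave

/-! ### The case c ≤ a + b: freeness over the endpoint variables. -/

theorem apply_one_add_apply_two_le_one_of_mem_support {K : Type*} [Field K]
    (p q s : MvPolynomial (Fin 2) K) {n : Fin 4 →₀ ℕ}
    (hn : n ∈ (rename ![0, 3] p + rename ![0, 3] q * X 1 + rename ![0, 3] s * X 2 :
      MvPolynomial (Fin 4) K).support) : n 1 + n 2 ≤ 1 := by
  have h0 : ∀ (r : MvPolynomial (Fin 2) K) (m : Fin 4 →₀ ℕ),
      m ∈ (rename ![0, 3] r : MvPolynomial (Fin 4) K).support → m 1 = 0 ∧ m 2 = 0 := by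
    intro r m hm
    obtain ⟨u, rfl, -⟩ := coeff_rename_ne_zero _ _ _ (mem_support_iff.mp hm)
    exact ⟨Finsupp.mapDomain_of_notMem_range _ _ (by decide),
      Finsupp.mapDomain_of_notMem_range _ _ (by decide)⟩
  have h1 : ∀ (r : MvPolynomial (Fin 2) K) (j : Fin 4) (m : Fin 4 →₀ ℕ),
      m ∈ (rename ![0, 3] r * X j : MvPolynomial (Fin 4) K).support → (j = 1 ∨ j = 2) →
      m 1 + m 2 ≤ 1 := by
    intro r j m hm hj
    rw [support_mul_X, Finset.mem_map] at hm
    obtain ⟨u, hu, rfl⟩ := hm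
    obtain ⟨hu1, hu2⟩ := h0 r u hu
    rcases hj with rfl | rfl <;> simp [hu1, hu2]
  rcases Finset.mem_union.mp (support_add hn) with hn | hn
  · rcases Finset.mem_union.mp (support_add hn) with hn | hn
    · have := h0 p n hn
      omega
    · exact h1 q 1 n hn (Or.inl rfl)
  · exact h1 s 2 n hn (Or.inr rfl)

/-- A quotient of `K[T₀, T₁, T₂, T₃]` in which `T₁², T₁T₂, T₂²` are multiples of
`T₀T₂, T₀T₃, T₁T₃` by a constant and which has no relations in the span of `1, T₁, T₂` over
`K[T₀, T₃]` is free over `K[T₀, T₃]` with basis `1, T₁, T₂`. -/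
theorem isCohenMacaulayRing_and_depthOf_eq_two_of_endpoints {K R : Type*} [Field K] [CommRing R]
    [Algebra K R] {T : Fin 4 → R} (hT : Function.Surjective (aeval (R := K) T)) (k : K)
    (h11 : T 1 * T 1 = algebraMap K R k * (T 0 * T 2))
    (h12 : T 1 * T 2 = algebraMap K R k * (T 0 * T 3))
    (h22 : T 2 * T 2 = algebraMap K R k * (T 1 * T 3))
    (hker : ∀ p q s : MvPolynomial (Fin 2) K,
      aeval T (rename ![0, 3] p + rename ![0, 3] q * X 1 + rename ![0, 3] s * X 2) = 0 →
      (rename ![0, 3] p + rename ![0, 3] q * X 1 + rename ![0, 3] s * X 2 :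
        MvPolynomial (Fin 4) K) = 0)
    {J : Ideal R} (hJ : J ≠ ⊤) (hmem : ∀ i, T i ∈ J) :
    depthOf J = 2 ∧ IsCohenMacaulayRing R := by
  have hθ0 : (T ∘ ![0, 3]) (0 : Fin 2) = T 0 := rfl
  have hθ1 : (T ∘ ![0, 3]) (1 : Fin 2) = T 3 := rfl
  refine isCohenMacaulayRing_and_depthOf_eq_two (K := K) (T ∘ ![0, 3]) (T 1) (T 2) ?_ ?_ hJ
    fun i => hmem _
  · refine forall_mem_span_one_pair hT _ (fun i => ?_)
      ⟨0, 0, C k * X 0, ?_⟩ ⟨C k * (X 0 * X 1), 0, 0, ?_⟩ ⟨0, C k * X 1, 0, ?_⟩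
    · fin_cases i
      · exact ⟨X 0, 0, 0, by simp⟩
      · exact ⟨0, 1, 0, by simp⟩
      · exact ⟨0, 0, 1, by simp⟩
      · exact ⟨X 1, 0, 0, by simp⟩
    · simp only [map_zero, map_mul, aeval_C, aeval_X, hθ0]
      linear_combination h11
    · simp only [map_zero, map_mul, aeval_C, aeval_X, hθ0, hθ1]
      linear_combination h12
    · simp only [map_zero, map_mul, aeval_C, aeval_X, hθ1]
      linear_combination h22
  · intro p q s h
    have hP := hker p q s (by
      rw [map_add, map_add, map_mul, map_mul, aeval_X, aeval_X, aeval_rename, aeval_rename,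
        aeval_rename]
      exact h)
    have hev : ∀ (u v : MvPolynomial (Fin 2) K) (r : MvPolynomial (Fin 2) K),
        aeval (![X 0, u, v, X 1] : Fin 4 → MvPolynomial (Fin 2) K) (rename ![0, 3] r) = r := by
      intro u v r
      have : (![X 0, u, v, X 1] : Fin 4 → MvPolynomial (Fin 2) K) ∘ ![0, 3] = X := by
        funext i
        fin_cases i <;> rfl
      rw [aeval_rename, this, aeval_X_left_apply]
    -- T₁ and T₂ may be specialised freely; the pairs (0, 0), (1, 0), (0, 1) isolate p, q and s.
    have H : ∀ u v : MvPolynomial (Fin 2) K, p + q * u + s * v = 0 := by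
      intro u v
      have := congrArg (aeval (![X 0, u, v, X 1] : Fin 4 → MvPolynomial (Fin 2) K)) hP
      rw [map_add, map_add, map_mul, map_mul, hev, hev, hev, aeval_X, aeval_X, map_zero] at this
      exact this
    have hp : p = 0 := by simpa using H 0 0
    have hq : q = 0 := by simpa [hp] using H 1 0
    have hs : s = 0 := by simpa [hp] using H 0 1
    exact ⟨hp, hq, hs⟩

theorem relation_eq_zero_of_unique {K : Type*} [Field K] {e : Fin 4 → ℕ × ℕ}
    (hmin : ∀ n n' : Fin 4 →₀ ℕ, n 1 + n 2 ≤ 1 → n'.degree = n.degree →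
      Finsupp.weight e n' ≤ Finsupp.weight e n → Finsupp.weight e n' = Finsupp.weight e n)
    (huniq : ∀ n n' : Fin 4 →₀ ℕ, n 1 + n 2 ≤ 1 → n' 1 + n' 2 ≤ 1 → n'.degree = n.degree →
      Finsupp.weight e n' = Finsupp.weight e n → n' = n)
    {p q s : MvPolynomial (Fin 2) K}
    (h : aeval (fiberGen K e)
      (rename ![0, 3] p + rename ![0, 3] q * X 1 + rename ![0, 3] s * X 2) = 0) :
    (rename ![0, 3] p + rename ![0, 3] q * X 1 + rename ![0, 3] s * X 2 :
      MvPolynomial (Fin 4) K) = 0 := by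
  ext n
  rw [coeff_zero]
  by_contra hne
  have hn := apply_one_add_apply_two_le_one_of_mem_support p q s (mem_support_iff.mpr hne)
  exact hne (coeff_eq_zero_of_aeval_fiberGen_eq_zero h
    (fun n' hn' h1 h2 => huniq n n' hn
      (apply_one_add_apply_two_le_one_of_mem_support p q s hn') h1 h2)
    fun n' h1 h2 => hmin n n' hn h1 h2)

theorem depth_eq_two_and_isCohenMacaulay_of_lt_add (K : Type*) [Field K] {a b c : ℕ}
    (hab : a < b) (hbc : b < c) (hc : c < a + b) (h₁ : b ≤ 2 * a) (h₂ : a + c ≤ 2 * b) :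
    fiberConeDepth (monomialIdeal K (symExp a b c)) = 2 ∧
      IsCohenMacaulayRing (fiberCone (monomialIdeal K (symExp a b c))) := by
  refine isCohenMacaulayRing_and_depthOf_eq_two_of_endpoints
    (aeval_fiberGen_surjective (K := K) (symExp a b c)) 0 ?_ ?_ ?_ (fun p q s h =>
      relation_eq_zero_of_unique (fun n n' hn hd hw => congrArg _
        (eq_of_weight_le_of_lt_add hd hab hbc hc hn hw)) (fun n n' hn _ hd hw =>
        eq_of_weight_le_of_lt_add hd hab hbc hc hn hw.le) h)
    (fiberConeIrrelevant_ne_top _) (fiberGen_mem_fiberConeIrrelevant _)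
  · rw [map_zero, zero_mul]
    refine fiberGen_mul_fiberGen_eq_zero (k := 0) (l := 2) ?_
    simp only [symExp, Matrix.cons_val, Prod.lt_iff, Prod.mk_add_mk]
    omega
  · rw [map_zero, zero_mul]
    refine fiberGen_mul_fiberGen_eq_zero (k := 0) (l := 3) ?_
    simp only [symExp, Matrix.cons_val, Prod.lt_iff, Prod.mk_add_mk]
    omega
  · rw [map_zero, zero_mul]
    refine fiberGen_mul_fiberGen_eq_zero (k := 1) (l := 3) ?_
    simp only [symExp, Matrix.cons_val, Prod.lt_iff, Prod.mk_add_mk]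
    omega

theorem depth_eq_two_and_isCohenMacaulay_of_eq_mul (K : Type*) [Field K] {a b c : ℕ} (ha : 0 < a)
    (hb : b = 2 * a) (hc : c = 3 * a) :
    fiberConeDepth (monomialIdeal K (symExp a b c)) = 2 ∧
      IsCohenMacaulayRing (fiberCone (monomialIdeal K (symExp a b c))) := by
  refine isCohenMacaulayRing_and_depthOf_eq_two_of_endpoints
    (aeval_fiberGen_surjective (K := K) (symExp a b c)) 1 ?_ ?_ ?_ (fun p q s h =>
      relation_eq_zero_of_unique (fun n n' _ hd hw => weight_eq_of_weight_le_of_eq_mul hd hb hc hw)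
        (fun n n' hn hn' hd hw => eq_of_weight_eq_of_eq_mul hd ha hb hc hn hn' hw) h)
    (fiberConeIrrelevant_ne_top _) (fiberGen_mem_fiberConeIrrelevant _)
  all_goals
    rw [map_one, one_mul]
    refine fiberGen_mul_fiberGen_eq ?_
    simp only [symExp, Matrix.cons_val, Prod.mk_add_mk, Prod.mk.injEq]
    omega

/-! ### Convexity and concavity -/

theorem symmetricIdeal_eq_monomialIdeal (K : Type*) [Field K] (a b c : ℕ) :
    symmetricIdeal K a b c = monomialIdeal K (symExp a b c) := by
  rw [symmetricIdeal, monomialIdeal]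
  congr 1
  ext f
  simp [Fin.exists_fin_succ, symExp, mono, eq_comm]

theorem isMonomialIdeal_monomialIdeal (K : Type*) [Field K] {ι : Type*} (e : ι → ℕ × ℕ) :
    IsMonomialIdeal (monomialIdeal K e) :=
  ⟨Set.range e, by rw [monomialIdeal, ← Set.range_comp]; rfl⟩

theorem mono_mem_monomialIdeal_iff {K : Type*} [Field K] {ι : Type*} {e : ι → ℕ × ℕ}
    {v : ℕ × ℕ} : mono K v ∈ monomialIdeal K e ↔ ∃ i, e i ≤ v := by
  have h : monomialIdeal K e = Ideal.span ((fun s => monomial s (1 : K)) ''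
      Set.range fun i => expFinsupp (e i)) := by
    rw [monomialIdeal, ← Set.range_comp]
    simp only [mono_eq_monomial]
    rfl
  rw [h, mem_ideal_span_monomial_image, mono_eq_monomial]
  simp [expFinsupp_le_iff]

/-- Exponent vectors forming an antichain are exactly the minimal ones. -/
theorem genExponents_monomialIdeal (K : Type*) [Field K] {ι : Type*} {e : ι → ℕ × ℕ}
    (he : ∀ i j, e i ≤ e j → i = j) : genExponents (monomialIdeal K e) = Set.range e := by
  ext v
  simp only [genExponents, Set.mem_ofPred_eq, mono_mem_monomialIdeal_iff, Set.mem_range]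
  constructor
  · rintro ⟨⟨i, hi⟩, hmin⟩
    exact ⟨i, le_antisymm hi (hmin ⟨i, le_rfl⟩ hi)⟩
  · rintro ⟨i, rfl⟩
    refine ⟨⟨i, le_rfl⟩, fun w ⟨j, hj⟩ hw => ?_⟩
    obtain rfl := he j i (hj.trans hw)
    exact hj

theorem isExponentSequence_symExp (K : Type*) [Field K] {a b c : ℕ} (ha : 0 < a) (hab : a < b)
    (hbc : b < c) : IsExponentSequence (monomialIdeal K (symExp a b c)) (symExp a b c) := by
  refine ⟨?_, (genExponents_monomialIdeal K fun i j h => ?_).symm⟩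
  · refine Fin.strictAnti_iff_succ_lt.mpr fun i => ?_
    rw [Prod.Lex.toLex_lt_toLex]
    left
    fin_cases i <;> simpa [symExp]
  · fin_cases i <;> fin_cases j <;> simp [symExp] at h ⊢ <;> omega

theorem isConvexSeq_symExp {a b c : ℕ} (h₁ : 2 * a ≤ b) (h₂ : 2 * b ≤ a + c) :
    IsConvexSeq (symExp a b c) := by
  intro i j k hij hjk
  fin_cases i <;> fin_cases j <;> simp at hij <;> fin_cases k <;> simp at hjk <;>
    simp [symExp] <;> omega

theorem isConcaveSeq_symExp {a b c : ℕ} (h₁ : b ≤ 2 * a) (h₂ : a + c ≤ 2 * b) :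
    IsConcaveSeq (symExp a b c) := by
  intro i j k hij hjk
  fin_cases i <;> fin_cases j <;> simp at hij <;> fin_cases k <;> simp at hjk <;>
    simp [symExp] <;> omega

end FiberCone

end

theorem theorem3p2 {K : Type*} [Field K] (a b c : ℕ) (ha : 0 < a) (hab : a < b) (hbc : b < c) :
    (2 * a ≤ b ∧ 2 * b ≤ a + c →
      FiberCone.IsConvexIdeal (FiberCone.symmetricIdeal K a b c) ∧
      FiberCone.fiberConeDepth (FiberCone.symmetricIdeal K a b c) = 2 ∧
      FiberCone.IsCohenMacaulayRing
        (FiberCone.fiberCone (FiberCone.symmetricIdeal K a b c))) ∧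
    (b ≤ 2 * a ∧ a + c ≤ 2 * b →
      FiberCone.IsConcaveIdeal (FiberCone.symmetricIdeal K a b c) ∧
      FiberCone.fiberConeDepth (FiberCone.symmetricIdeal K a b c) = 2 ∧
      FiberCone.IsCohenMacaulayRing
        (FiberCone.fiberCone (FiberCone.symmetricIdeal K a b c))) := by
  rw [FiberCone.symmetricIdeal_eq_monomialIdeal]
  have hmon := FiberCone.isMonomialIdeal_monomialIdeal K (FiberCone.symExp a b c)
  have hseq := FiberCone.isExponentSequence_symExp K ha hab hbc
  refine ⟨fun ⟨h₁, h₂⟩ => ⟨⟨hmon, 4, _, hseq, FiberCone.isConvexSeq_symExp h₁ h₂⟩, ?_⟩,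
    fun ⟨h₁, h₂⟩ => ⟨⟨hmon, 4, _, hseq, FiberCone.isConcaveSeq_symExp h₁ h₂⟩, ?_⟩⟩
  -- c ≥ 2b − a ≥ a + b, and equality throughout forces b = 2a and c = 3a; the concave case reverses
  -- the inequalities.
  · rcases (show a + b ≤ c by omega).lt_or_eq with hc | hc
    · exact FiberCone.depth_eq_two_and_isCohenMacaulay_of_add_lt K ha hab hc h₁ h₂
    · exact FiberCone.depth_eq_two_and_isCohenMacaulay_of_eq_mul K ha (by omega) (by omega)
  · rcases (show c ≤ a + b by omega).lt_or_eq with hc | hc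
    · exact FiberCone.depth_eq_two_and_isCohenMacaulay_of_lt_add K hab hbc hc h₁ h₂
    · exact FiberCone.depth_eq_two_and_isCohenMacaulay_of_eq_mul K ha (by omega) (by omega)
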